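/- Let $\Phi$ be a homogeneous Poisson point process (PPP) in $\mathbb{R}^2$ with density $\lambda>0$. Two distinct atoms $x,y\in\Phi$ cooperate (are a pair) if each is a nearest neighbour of the other among the atoms of $\Phi$, i.e. $\|x-y\|\le\|x-z\|$ for all $z\in\Phi\setminus\{x\}$ and $\|x-y\|\le\|y-z\|$ for all $z\in\Phi\setminus\{y\}$. Let $\Phi^{(2)}$ be the set of the atoms of $\Phi$ that cooperate with another atom of $\Phi$, and let $\mathbb{P}^{(2),0}$ be the Palm probability of $\Phi^{(2)}$: for any bounded Borel set $D\subset\mathbb{R}^2$ of positive area and any event $\{\Phi\in C\}$, $$\mathbb{P}^{(2),0}(\Phi\in C)=\frac{\mathbb{E}\,\#\{x\in\Phi^{(2)}\cap D:\ \Phi-x\in C\}}{\mathbb{E}\,\#(\Phi^{(2)}\cap D)}.$$ Put $\gamma=\frac23-\frac{\sqrt3}{2\pi}$. Then $\Phi^{(2)}$ is a point process and, for every choice of the window $D$ above, its nearest-neighbour distribution function $G^{(2)}(r)=\mathbb{P}^{(2),0}\big(d(0,\Phi^{(2)}\setminus\{0\})\le r\big)$ is $$G^{(2)}(r)=1-e^{-\lambda\pi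 r^2(2-\gamma)}\qquad\text{for every } r>0.$$ Moreover, the distance between the two atoms of a cooperating pair, i.e. the distance from $0$ to the atom with which it cooperates under $\mathbb{P}^{(2),0}$, has the Rayleigh distribution with scale parameter $\alpha=(2\lambda\pi(2-\gamma))^{-1/2}$, whose density is $\frac{s}{\alpha^2}e^{-s^2/(2\alpha^2)}$ for $s\ge 0$. -/

import Mathlib

open MeasureTheory ProbabilityTheory
open scoped NNReal ENNReal

namespace PairedPoisson

/-- The Euclidean plane. -/
abbrev Plane : Type := EuclideanSpace ℝ (Fin 2)

/-- A configuration of atoms is locally finite if every bounded set contains finitely many atoms. -/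
def LocallyFiniteConfig (φ : Set Plane) : Prop :=
  ∀ B : Set Plane, Bornology.IsBounded B → (φ ∩ B).Finite

/-- A (simple) point process in the plane: a random locally finite set of atoms, all of whose counts
in bounded Borel sets are random variables. -/
structure IsPointProcess {Ω : Type*} [MeasurableSpace Ω] (Φ : Ω → Set Plane) : Prop where
  locallyFinite : ∀ ω, LocallyFiniteConfig (Φ ω)
  measurable_count : ∀ B : Set Plane, MeasurableSet B → Bornology.IsBounded B →
    Measurable fun ω => (Φ ω ∩ B).ncard

/-- A homogeneous Poisson point process (PPP) of density `lam` in the plane: the number of atoms in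
a bounded Borel set `B` has the Poisson law of mean `lam * area B`, and the numbers of atoms in
pairwise disjoint bounded Borel sets are independent. -/
structure IsPoissonProcess {Ω : Type*} [MeasurableSpace Ω] (μ : Measure Ω) (lam : ℝ≥0)
    (Φ : Ω → Set Plane) : Prop extends IsPointProcess Φ where
  hasLaw_count : ∀ B : Set Plane, MeasurableSet B → Bornology.IsBounded B →
    HasLaw (fun ω => (Φ ω ∩ B).ncard) (poissonMeasure (lam * (volume B).toNNReal)) μ
  indep_count : ∀ (n : ℕ) (B : Fin n → Set Plane), (∀ i, MeasurableSet (B i)) →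
    (∀ i, Bornology.IsBounded (B i)) → Pairwise (fun i j => Disjoint (B i) (B j)) →
    iIndepFun (fun i ω => (Φ ω ∩ B i).ncard) μ

/-- `x` is in nearest neighbour relation with `y`, with respect to `φ`: both are atoms of `φ`, and
`y` minimises the distance to `x` among the atoms of `φ` other than `x`. -/
def IsNearest (φ : Set Plane) (x y : Plane) : Prop :=
  x ∈ φ ∧ y ∈ φ \ {x} ∧ ∀ z ∈ φ \ {x}, dist x y ≤ dist x z

/-- `x` and `y` are mutually nearest neighbours (they cooperate). -/
def IsMutuallyNearest (φ : Set Plane) (x y : Plane) : Prop :=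
  IsNearest φ x y ∧ IsNearest φ y x

/-- The atoms of `φ` that cooperate with another atom of `φ`. -/
def pairedAtoms (φ : Set Plane) : Set Plane :=
  {x | x ∈ φ ∧ ∃ y, IsMutuallyNearest φ x y}

/-- The configuration `φ` seen from `x`: the translate of `φ` that moves `x` to the origin. -/
def seenFrom (x : Plane) (φ : Set Plane) : Set Plane :=
  (fun z => z - x) '' φ

/-- The Palm probability of the point process `Ψ`, applied to the event `Φ ∈ C`: the mean number of
atoms `x` of `Ψ` in the window `D` from which the configuration `Φ` is seen in `C`, divided by the
mean number of atoms of `Ψ` in `D`. (When `Ψ` and `Φ` are jointly stationary, this does not depend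
on the window.) -/
noncomputable def palmProb {Ω : Type*} [MeasurableSpace Ω] (μ : Measure Ω) (Ψ Φ : Ω → Set Plane)
    (D : Set Plane) (C : Set (Set Plane)) : ℝ≥0∞ :=
  (∫⁻ ω, (({x | x ∈ Ψ ω ∩ D ∧ seenFrom x (Φ ω) ∈ C}.encard : ℕ∞) : ℝ≥0∞) ∂μ) /
    ∫⁻ ω, (((Ψ ω ∩ D).encard : ℕ∞) : ℝ≥0∞) ∂μ

/-- The nearest-neighbour distribution function of the process of paired atoms of `Φ`: the
probability, under the Palm probability of the paired atoms, that the distance from the origin to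
the other paired atoms is at most `r`. -/
noncomputable def pairedNN {Ω : Type*} [MeasurableSpace Ω] (μ : Measure Ω) (Φ : Ω → Set Plane)
    (D : Set Plane) (r : ℝ) : ℝ≥0∞ :=
  palmProb μ (fun ω => pairedAtoms (Φ ω)) Φ D
    {φ | Metric.infEDist 0 (pairedAtoms φ \ {0}) ≤ ENNReal.ofReal r}

/-- The law of the distance between the two atoms of a cooperating pair: the probability, under the
Palm probability of the paired atoms, that the distance from the origin to the atom with which it
cooperates lies in `A`. -/
noncomputable def pairDistanceLaw {Ω : Type*} [MeasurableSpace Ω] (μ : Measure Ω)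
    (Φ : Ω → Set Plane) (D : Set Plane) (A : Set ℝ) : ℝ≥0∞ :=
  palmProb μ (fun ω => pairedAtoms (Φ ω)) Φ D
    {φ | ∃ y, IsMutuallyNearest φ 0 y ∧ dist 0 y ∈ A}

/-- The area, divided by `π`, of the intersection of two unit discs, each centred on the boundary
circle of the other. -/
noncomputable def gam : ℝ := 2 / 3 - √3 / (2 * Real.pi)

/-- The Rayleigh distribution with scale parameter `σ`. -/
noncomputable def rayleighMeasure (σ : ℝ) : Measure ℝ :=
  volume.withDensity fun s =>
    ENNReal.ofReal (if 0 ≤ s then s / σ ^ 2 * Real.exp (-s ^ 2 / (2 * σ ^ 2)) else 0)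

end PairedPoisson

namespace PairedPoisson

/-! Two atoms `x`, `y` cooperate exactly when no other atom lies in the union of the two open discs
centred at `x` and `y` with radius `dist x y` (`isMutuallyNearest_iff`). That union has area π(2 −
γ)s², where s = `dist x y` (`volume_twoDiscs`), so a Poisson process leaves it empty with
probability exp(−κs²), κ = λπ(2 − γ).

The Mecke equation for pairs (`IsPoissonProcess.lintegral_mecke_pair`) then gives the mean number of
ordered cooperating pairs with first atom in D and distance in A: it is λ²|D| times the integral of
exp(−κ|y|²) over |y| ∈ A. In polar coordinates this is λ²|D|(π/κ) times the Rayleigh measure of A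
(`lintegral_gaussian_norm`). Almost surely no atom has two others at the same distance
(`IsPoissonProcess.ae_dist_ne`), so each paired atom has one partner and counting pairs is counting
paired atoms. Dividing by the case A = ℝ gives the law of the pair distance. The partner of a paired
atom is nearest among all atoms and is itself paired, so G is the distribution function of that same
law.

The Mecke equation is derived from the counts alone. The σ-algebra on configurations is generated by
the void events, a π-system, so the reduced Campbell measure need only be computed on products of a
void event and a bounded window (`IsPoissonProcess.lintegral_atoms_remove`). -/

/-! ### The measurable space of configurations -/

/-- The space of locally finite configurations. -/
structure Config where
  /-- The set of atoms. -/
  carrier : Set Plane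
  locallyFinite : LocallyFiniteConfig carrier

/-- The event that a configuration has no atom in `B`. -/
def voidEvent (B : Set Plane) : Set Config := {φ | φ.1 ∩ B = ∅}

/-- The void events of bounded Borel sets. -/
def voidEvents : Set (Set Config) :=
  {S | ∃ B : Set Plane, MeasurableSet B ∧ Bornology.IsBounded B ∧ S = voidEvent B}

instance : MeasurableSpace Config := MeasurableSpace.generateFrom voidEvents

lemma isPiSystem_voidEvents : IsPiSystem voidEvents := by
  rintro _ ⟨B, hB, hB', rfl⟩ _ ⟨C, hC, hC', rfl⟩ -
  refine ⟨B ∪ C, hB.union hC, hB'.union hC', ?_⟩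
  ext φ
  simp [voidEvent, Set.inter_union_distrib_left]

lemma measurableSet_voidEvent {B : Set Plane} (hB : MeasurableSet B)
    (hB' : Bornology.IsBounded B) : MeasurableSet (voidEvent B) :=
  MeasurableSpace.measurableSet_generateFrom ⟨B, hB, hB', rfl⟩

lemma voidEvent_empty : voidEvent ∅ = Set.univ := by
  ext φ; simp [voidEvent]

/-- The first `n` binary digits of a point, in an injective Borel encoding of the plane. -/
noncomputable def bits (n : ℕ) (x : Plane) : Fin n → Bool :=
  fun i => MeasurableSpace.mapNatBool Plane x i

lemma measurable_bits (n : ℕ) : Measurable (bits n) :=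
  measurable_pi_lambda _ fun i =>
    (measurable_pi_apply (i : ℕ)).comp (MeasurableSpace.measurable_mapNatBool Plane)

/-- Some digit separates each pair of distinct points, and a finite set has finitely many pairs. -/
lemma eventually_injOn_bits {T : Set Plane} (hT : T.Finite) :
    ∀ᶠ n in Filter.atTop, Set.InjOn (bits n) T := by
  have h : ∀ x ∈ T, ∀ᶠ n in Filter.atTop, ∀ y ∈ T, bits n x = bits n y → x = y := by
    intro x _
    rw [Set.Finite.eventually_all hT]
    intro y _
    by_cases hxy : x = y
    · simp [hxy]
    · have := fun h => hxy (MeasurableSpace.injective_mapNatBool Plane h)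
      obtain ⟨k, hk⟩ := Function.ne_iff.1 this
      filter_upwards [Filter.eventually_gt_atTop k] with n hn h
      exact absurd (congrFun h ⟨k, hn⟩) hk
  rw [← Set.Finite.eventually_all hT] at h
  filter_upwards [h] with n hn x hx y hy hxy using hn x hx y hy hxy

/-- Void events determine all counts: the first `n` digits cut `B` into finitely many cells, and the
number of non-empty cells equals the number of atoms once the digits separate them. -/
lemma measurable_ncard {B : Set Plane} (hB : MeasurableSet B) (hB' : Bornology.IsBounded B) :
    Measurable fun φ : Config => (φ.1 ∩ B).ncard := by
  classical
  have hm : ∀ n, Measurable fun φ : Config =>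
      ∑ s : Fin n → Bool, if φ ∈ voidEvent (B ∩ bits n ⁻¹' {s}) then 0 else 1 := by
    intro n
    refine Finset.measurable_sum _ fun s _ => Measurable.ite ?_ measurable_const measurable_const
    exact measurableSet_voidEvent (hB.inter (measurable_bits n (measurableSet_singleton s)))
      (hB'.subset Set.inter_subset_left)
  refine measurable_of_tendsto_metrizable hm ?_
  rw [tendsto_pi_nhds]
  intro φ
  refine tendsto_const_nhds.congr' ?_
  filter_upwards [eventually_injOn_bits (φ.2 B hB')] with n hn
  have hs : ∀ s, φ ∈ voidEvent (B ∩ bits n ⁻¹' {s}) ↔ s ∉ bits n '' (φ.1 ∩ B) := by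
    intro s
    simp only [voidEvent, Set.mem_ofPred_eq, Set.eq_empty_iff_forall_notMem, Set.mem_image,
      Set.mem_inter_iff, Set.mem_preimage, Set.mem_singleton_iff, not_exists, not_and]
    grind
  rw [← hn.ncard_image, Set.ncard_eq_toFinset_card']
  simp only [hs, ite_not, Finset.sum_boole, Nat.cast_id]
  congr 1
  ext s
  simp

lemma Config.countable (φ : Config) : φ.1.Countable := by
  have : φ.1 = ⋃ n : ℕ, φ.1 ∩ Metric.ball 0 n := by
    rw [← Set.inter_iUnion, Metric.iUnion_ball_nat, Set.inter_univ]
  rw [this]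
  exact Set.countable_iUnion fun n => (φ.2 _ Metric.isBounded_ball).countable

/-! ### The kernel of atoms, and removal of an atom -/

/-- The counting measure of a configuration. -/
noncomputable def atomMeasure (φ : Config) : Measure Plane := Measure.count.restrict φ.1

lemma atomMeasure_apply (φ : Config) (S : Set Plane) :
    atomMeasure φ S = ((φ.1 ∩ S).encard : ℕ∞) := by
  rw [atomMeasure, Measure.restrict_apply' φ.countable.measurableSet, Set.inter_comm,
    Measure.count_apply (φ.countable.mono Set.inter_subset_left).measurableSet]

lemma atomMeasure_apply_of_isBounded (φ : Config) {S : Set Plane} (hS : Bornology.IsBounded S) :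
    atomMeasure φ S = ((φ.1 ∩ S).ncard : ℝ≥0∞) := by
  rw [atomMeasure_apply, ← (φ.2 S hS).cast_ncard_eq]
  simp

lemma measurable_atomMeasure : Measurable atomMeasure := by
  refine Measure.measurable_of_measurable_coe _ fun S hS => ?_
  have h : ∀ φ, atomMeasure φ S = ⨆ n : ℕ, ((φ.1 ∩ (S ∩ Metric.ball 0 n)).ncard : ℝ≥0∞) := by
    intro φ
    have hS' : S = ⋃ n : ℕ, S ∩ Metric.ball 0 n := by
      rw [← Set.inter_iUnion, Metric.iUnion_ball_nat, Set.inter_univ]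
    conv_lhs => rw [hS']
    rw [Monotone.measure_iUnion]
    · simp_rw [atomMeasure_apply_of_isBounded φ
        (Metric.isBounded_ball.subset Set.inter_subset_right)]
    · intro m n hmn
      exact Set.inter_subset_inter_right _ (Metric.ball_subset_ball (by exact_mod_cast hmn))
  simp_rw [h]
  refine Measurable.iSup fun n => ?_
  exact measurable_from_nat.comp (measurable_ncard (hS.inter measurableSet_ball)
    (Metric.isBounded_ball.subset Set.inter_subset_right))

/-- The kernel of counting measures of configurations. -/
noncomputable def atoms : Kernel Config Plane := ⟨atomMeasure, measurable_atomMeasure⟩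

lemma atoms_apply (φ : Config) (S : Set Plane) : atoms φ S = ((φ.1 ∩ S).encard : ℕ∞) :=
  atomMeasure_apply φ S

lemma atoms_apply_of_isBounded (φ : Config) {S : Set Plane} (hS : Bornology.IsBounded S) :
    atoms φ S = ((φ.1 ∩ S).ncard : ℝ≥0∞) :=
  atomMeasure_apply_of_isBounded φ hS

lemma atoms_eq_zero_iff (φ : Config) (S : Set Plane) : atoms φ S = 0 ↔ φ.1 ∩ S = ∅ := by
  rw [atoms_apply]; simp

lemma ae_atoms_iff (φ : Config) (p : Plane → Prop) : (∀ᵐ x ∂atoms φ, p x) ↔ ∀ x ∈ φ.1, p x := by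
  rw [ae_iff, atoms_eq_zero_iff, Set.eq_empty_iff_forall_notMem]
  simp

-- The number of atoms in a bounded region has no bound uniform in the configuration. Each annulus
-- `R j` is therefore split further by its number of atoms `k`: on that event the restricted kernel
-- has mass `k`.
open Classical in
instance : IsSFiniteKernel atoms := by
  have hB : ∀ j, Bornology.IsBounded (disjointed (fun n : ℕ => Metric.ball (0 : Plane) n) j) :=
    fun j => Metric.isBounded_ball.subset (disjointed_subset _ j)
  have hm : ∀ j, MeasurableSet (disjointed (fun n : ℕ => Metric.ball (0 : Plane) n) j) :=
    fun j => MeasurableSet.disjointed (fun n => measurableSet_ball) j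
  set R := disjointed (fun n : ℕ => Metric.ball (0 : Plane) n) with hR
  have hmk : ∀ j k, MeasurableSet {φ : Config | (φ.1 ∩ R j).ncard = k} := fun j k =>
    measurable_ncard (hm j) (hB j) (measurableSet_singleton k)
  let κ : ℕ → ℕ → Kernel Config Plane := fun j k =>
    Kernel.piecewise (hmk j k) (atoms.restrict (hm j)) 0
  have hκ : ∀ j k, IsFiniteKernel (κ j k) := by
    intro j k
    refine ⟨k, by simp, fun φ => ?_⟩
    simp only [κ, Kernel.piecewise_apply, Set.mem_ofPred_eq]
    split_ifs with h
    · rw [Kernel.restrict_apply, Measure.restrict_apply_univ, atoms_apply_of_isBounded _ (hB j), h]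
    · simp
  have hsum : atoms = Kernel.sum fun j => Kernel.sum (κ j) := by
    ext φ S hS
    rw [Kernel.sum_apply' _ _ hS]
    have h1 : ∀ j, Kernel.sum (κ j) φ S = atoms φ (S ∩ R j) := by
      intro j
      rw [Kernel.sum_apply' _ _ hS, tsum_eq_single (φ.1 ∩ R j).ncard]
      · simp [κ, Kernel.piecewise_apply, Kernel.restrict_apply, Measure.restrict_apply hS]
      · intro k hk
        simp [κ, Kernel.piecewise_apply, hk.symm]
    simp_rw [h1]
    rw [← measure_iUnion, ← Set.inter_iUnion, hR, iUnion_disjointed, Metric.iUnion_ball_nat,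
      Set.inter_univ]
    · exact fun i j hij => (disjoint_disjointed _ hij).mono Set.inter_subset_right
        Set.inter_subset_right
    · exact fun j => hS.inter (hm j)
  rw [hsum]
  infer_instance

/-- Removal of an atom. -/
def remove (p : Config × Plane) : Config :=
  ⟨p.1.1 \ {p.2}, fun B hB => (p.1.2 B hB).subset (Set.inter_subset_inter_left _ Set.sdiff_subset)⟩

/-- A quantifier over atoms says that the kernel `atoms` gives mass zero to the section of the
complement, and such masses are measurable in the parameter. -/
lemma measurableSet_forall_atoms {α : Type*} [MeasurableSpace α] {g : α → Config}
    (hg : Measurable g) {s : Set (α × Plane)} (hs : MeasurableSet s) :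
    MeasurableSet {a | ∀ x ∈ (g a).1, (a, x) ∈ s} := by
  have : {a | ∀ x ∈ (g a).1, (a, x) ∈ s} =
      (fun a => (atoms.comap g hg) a (Prod.mk a ⁻¹' sᶜ)) ⁻¹' {0} := by
    ext a
    simp only [Set.mem_ofPred_eq, Set.mem_preimage, Kernel.comap_apply, Set.mem_singleton_iff,
      atoms_eq_zero_iff, Set.eq_empty_iff_forall_notMem]
    simp
  rw [this]
  exact Kernel.measurable_kernel_prodMk_left hs.compl (measurableSet_singleton 0)

lemma measurableSet_exists_atoms {α : Type*} [MeasurableSpace α] {g : α → Config}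
    (hg : Measurable g) {s : Set (α × Plane)} (hs : MeasurableSet s) :
    MeasurableSet {a | ∃ x ∈ (g a).1, (a, x) ∈ s} := by
  convert (measurableSet_forall_atoms hg hs.compl).compl using 1
  ext a
  simp

lemma measurable_remove : Measurable remove := by
  refine measurable_generateFrom ?_
  rintro _ ⟨B, hB, -, rfl⟩
  have : remove ⁻¹' voidEvent B =
      {p | ∀ x ∈ p.1.1, (p, x) ∈ {q : (Config × Plane) × Plane | q.2 ∈ B → q.2 = q.1.2}} := by
    ext p
    simp only [remove, voidEvent, Set.mem_preimage, Set.mem_ofPred_eq,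
      Set.eq_empty_iff_forall_notMem, Set.mem_inter_iff, Set.mem_sdiff, Set.mem_singleton_iff]
    grind
  rw [this]
  refine measurableSet_forall_atoms measurable_fst ?_
  have h1 : MeasurableSet {q : (Config × Plane) × Plane | q.2 ∈ B} := measurable_snd hB
  have h2 : MeasurableSet {q : (Config × Plane) × Plane | q.2 = q.1.2} :=
    measurableSet_eq_fun measurable_snd (measurable_snd.comp measurable_fst)
  convert h1.compl.union h2 using 1
  ext q
  simp [imp_iff_not_or]

/-! ### Poisson counts and the Mecke equation -/

lemma lintegral_natCast_poissonMeasure (r : ℝ≥0) : ∫⁻ n, (n : ℝ≥0∞) ∂poissonMeasure r = r := by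
  have h1 : ∫⁻ n, (n : ℝ≥0∞) ∂poissonMeasure r = ∑' n : ℕ, (n : ℝ≥0∞) * poissonMeasure r {n} :=
    lintegral_countable' _
  have h2 : ∑' n : ℕ, poissonMeasure r {n} = 1 := by
    rw [← measure_univ (μ := poissonMeasure r)]
    simpa using (lintegral_countable' (μ := poissonMeasure r) (fun _ => (1 : ℝ≥0∞))).symm
  rw [h1, tsum_eq_zero_add' ENNReal.summable]
  have h3 : ∀ n : ℕ, ((n + 1 : ℕ) : ℝ≥0∞) * poissonMeasure r {n + 1} =
      r * poissonMeasure r {n} := by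
    intro n
    rw [poissonMeasure_singleton, poissonMeasure_singleton, ← ENNReal.ofReal_natCast,
      ← ENNReal.ofReal_coe_nnreal, ← ENNReal.ofReal_mul (by positivity),
      ← ENNReal.ofReal_mul (by positivity), Nat.factorial_succ]
    congr 1
    push_cast
    field_simp
    ring
  simp_rw [h3]
  rw [ENNReal.tsum_mul_left, h2]
  simp

/-- The indicator of `k`, evaluated at `n`. -/
noncomputable def countIs (k n : ℕ) : ℝ≥0∞ := if n = k then 1 else 0

lemma measurable_countIs (k : ℕ) : Measurable (countIs k) := measurable_from_nat

/-- If `φ` misses `B`, every point of `φ` in `A` qualifies, and lies in `A \ B`. Otherwise only the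
unique point of `φ ∩ B` can qualify, and it must lie in `A`. The right side is written with counts
in disjoint sets, so that independence applies to each product. -/
lemma ncard_forall_eq {α : Type*} {φ A B : Set α} (hB : (φ ∩ B).Finite) :
    ((φ ∩ {x | x ∈ A ∧ ∀ z ∈ φ, z ∈ B → z = x}).ncard : ℝ≥0∞) =
      countIs 0 (φ ∩ B).ncard * ((φ ∩ (A \ B)).ncard : ℝ≥0∞) +
        countIs 0 (φ ∩ (B \ A)).ncard * countIs 1 (φ ∩ (A ∩ B)).ncard := by
  have hBA : (φ ∩ (B \ A)).Finite := hB.subset (Set.inter_subset_inter_right _ Set.sdiff_subset)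
  simp only [countIs, Set.ncard_eq_zero hB, Set.ncard_eq_zero hBA, Set.ncard_eq_one]
  by_cases h0 : φ ∩ B = ∅
  · have h1 : φ ∩ (A ∩ B) = ∅ := by grind
    have h2 : φ ∩ {x | x ∈ A ∧ ∀ z ∈ φ, z ∈ B → z = x} = φ ∩ (A \ B) := by
      have h0' : ∀ z ∈ φ, z ∉ B := fun z hz hzB => Set.eq_empty_iff_forall_notMem.1 h0 z ⟨hz, hzB⟩
      ext z
      exact ⟨fun h => ⟨h.1, h.2.1, h0' z h.1⟩,
        fun h => ⟨h.1, h.2.1, fun y hy hyB => absurd hyB (h0' y hy)⟩⟩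
    simp [h0, h1, h2]
  · by_cases h1 : φ ∩ (B \ A) = ∅ ∧ ∃ a, φ ∩ (A ∩ B) = {a}
    · obtain ⟨h1, a, ha⟩ := h1
      have h2 : φ ∩ {x | x ∈ A ∧ ∀ z ∈ φ, z ∈ B → z = x} = {a} := by
        simp only [Set.ext_iff, Set.mem_inter_iff, Set.mem_ofPred_eq, Set.mem_sdiff,
          Set.mem_singleton_iff, Set.mem_empty_iff_false] at h1 ha ⊢
        have := (ha a).2 rfl
        grind
      simp [h0, h1, ha, h2]
    · have h2 : φ ∩ {x | x ∈ A ∧ ∀ z ∈ φ, z ∈ B → z = x} = ∅ := by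
        by_contra hne
        obtain ⟨x, hx, hxA, hxB⟩ := Set.nonempty_iff_ne_empty.2 hne
        obtain ⟨z, hz, hzB⟩ := Set.nonempty_iff_ne_empty.2 h0
        have := hxB z hz hzB
        subst this
        refine h1 ⟨?_, z, ?_⟩
        · ext y
          simp only [Set.mem_inter_iff, Set.mem_sdiff, Set.mem_empty_iff_false, iff_false]
          rintro ⟨hy, hyB, hyA⟩
          exact hyA (hxB y hy hyB ▸ hxA)
        · ext y
          simp only [Set.mem_inter_iff, Set.mem_singleton_iff]
          exact ⟨fun h => hxB y h.1 h.2.2, fun h => h ▸ ⟨hz, hxA, hzB⟩⟩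
      rw [h2]
      rcases not_and_or.1 h1 with h | h <;> simp [h0, h]

lemma atoms_remove_mem_voidEvent (φ : Config) {A B : Set Plane} (hA' : Bornology.IsBounded A)
    (hB' : Bornology.IsBounded B) :
    atoms φ {x | x ∈ A ∧ remove (φ, x) ∈ voidEvent B} =
      countIs 0 (φ.1 ∩ B).ncard * ((φ.1 ∩ (A \ B)).ncard : ℝ≥0∞) +
        countIs 0 (φ.1 ∩ (B \ A)).ncard * countIs 1 (φ.1 ∩ (A ∩ B)).ncard := by
  have hbd : Bornology.IsBounded {x | x ∈ A ∧ remove (φ, x) ∈ voidEvent B} :=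
    hA'.subset fun x hx => hx.1
  rw [atoms_apply_of_isBounded _ hbd]
  have hmem : ∀ x, remove (φ, x) ∈ voidEvent B ↔ ∀ z ∈ φ.1, z ∈ B → z = x := by
    intro x
    simp only [remove, voidEvent, Set.mem_ofPred_eq,
      Set.eq_empty_iff_forall_notMem, Set.mem_inter_iff, Set.mem_sdiff, Set.mem_singleton_iff]
    grind
  simp only [hmem]
  exact ncard_forall_eq (φ.2 B hB')

section Poisson

variable {Ω : Type*} [MeasurableSpace Ω] {μ : Measure Ω} {lam : ℝ≥0} {Φ : Ω → Set Plane}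

/-- A point process as a random configuration. -/
def IsPointProcess.config (hΦ : IsPointProcess Φ) (ω : Ω) : Config := ⟨Φ ω, hΦ.locallyFinite ω⟩

lemma IsPointProcess.measurable_config (hΦ : IsPointProcess Φ) : Measurable hΦ.config := by
  refine measurable_generateFrom ?_
  rintro _ ⟨B, hB, hB', rfl⟩
  convert hΦ.measurable_count B hB hB' (measurableSet_singleton 0) using 1
  ext ω
  simp [voidEvent, config, Set.ncard_eq_zero (hΦ.locallyFinite ω B hB')]

lemma IsPoissonProcess.lintegral_count (hΦ : IsPoissonProcess μ lam Φ) {B : Set Plane}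
    (hB : MeasurableSet B) (hB' : Bornology.IsBounded B) :
    ∫⁻ ω, ((Φ ω ∩ B).ncard : ℝ≥0∞) ∂μ = lam * volume B := by
  rw [(hΦ.hasLaw_count B hB hB').lintegral_comp (f := fun n : ℕ => (n : ℝ≥0∞))
    measurable_from_nat.aemeasurable, lintegral_natCast_poissonMeasure, ENNReal.coe_mul,
    ENNReal.coe_toNNReal hB'.measure_lt_top.ne]

lemma IsPoissonProcess.lintegral_countIs (hΦ : IsPoissonProcess μ lam Φ) (k : ℕ) {B : Set Plane}
    (hB : MeasurableSet B) (hB' : Bornology.IsBounded B) :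
    ∫⁻ ω, countIs k (Φ ω ∩ B).ncard ∂μ =
      poissonMeasure (lam * (volume B).toNNReal) {k} := by
  rw [(hΦ.hasLaw_count B hB hB').lintegral_comp (f := countIs k)
    (measurable_countIs k).aemeasurable, ← lintegral_indicator_one (measurableSet_singleton k)]
  congr with n
  simp [countIs, Set.indicator_apply]

lemma IsPoissonProcess.lintegral_mul (hΦ : IsPoissonProcess μ lam Φ) {A B : Set Plane}
    (hA : MeasurableSet A) (hA' : Bornology.IsBounded A)
    (hB : MeasurableSet B) (hB' : Bornology.IsBounded B) (hAB : Disjoint A B)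
    (f g : ℕ → ℝ≥0∞) :
    ∫⁻ ω, f (Φ ω ∩ A).ncard * g (Φ ω ∩ B).ncard ∂μ =
      (∫⁻ ω, f (Φ ω ∩ A).ncard ∂μ) * ∫⁻ ω, g (Φ ω ∩ B).ncard ∂μ := by
  have h := hΦ.indep_count 2 ![A, B] (by simp [Fin.forall_fin_two, hA, hB])
    (by simp [Fin.forall_fin_two, hA', hB'])
    (by
      intro i j hij
      fin_cases i <;> fin_cases j <;> simp_all [disjoint_comm])
  have h' := (h.indepFun (show (0 : Fin 2) ≠ 1 by decide)).comp
    (measurable_from_nat (f := f) : Measurable f) (measurable_from_nat (f := g) : Measurable g)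
  exact lintegral_mul_eq_lintegral_mul_lintegral_of_indepFun
    (measurable_from_nat.comp (hΦ.measurable_count A hA hA'))
    (measurable_from_nat.comp (hΦ.measurable_count B hB hB')) h'

lemma poissonMeasure_singleton_zero (r : ℝ≥0) :
    poissonMeasure r {0} = ENNReal.ofReal (Real.exp (-r)) := by
  simp [poissonMeasure_singleton]

lemma poissonMeasure_singleton_one (r : ℝ≥0) :
    poissonMeasure r {1} = ENNReal.ofReal (Real.exp (-r)) * r := by
  rw [poissonMeasure_singleton, ← ENNReal.ofReal_coe_nnreal, ← ENNReal.ofReal_mul (by positivity)]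
  simp

/-- The law of a point process on the space of configurations. -/
noncomputable def IsPoissonProcess.law (hΦ : IsPoissonProcess μ lam Φ) : Measure Config :=
  μ.map hΦ.config

lemma IsPoissonProcess.law_voidEvent (hΦ : IsPoissonProcess μ lam Φ) {B : Set Plane}
    (hB : MeasurableSet B) (hB' : Bornology.IsBounded B) :
    hΦ.law (voidEvent B) = ENNReal.ofReal (Real.exp (-(lam * (volume B).toReal))) := by
  have h := hΦ.lintegral_countIs 0 hB hB'
  rw [poissonMeasure_singleton_zero] at h
  rw [law, Measure.map_apply hΦ.measurable_config (measurableSet_voidEvent hB hB'),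
    ← lintegral_indicator_one (hΦ.measurable_config (measurableSet_voidEvent hB hB'))]
  have hr : ((lam * (volume B).toNNReal : ℝ≥0) : ℝ) = lam * (volume B).toReal := by
    rw [NNReal.coe_mul, ENNReal.coe_toNNReal_eq_toReal]
  rw [← hr, ← h]
  congr with ω
  simp [countIs, Set.indicator_apply, voidEvent, IsPointProcess.config,
    Set.ncard_eq_zero (hΦ.locallyFinite ω B hB')]

/-- By independence the two terms of `ncard_forall_eq` have means exp(−λ|B|)·λ|A \ B| and exp(−λ|B \
A|)·exp(−λ|A ∩ B|)·λ|A ∩ B|. The exponentials of the second combine to exp(−λ|B|), and the areas add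
up to |A|. -/
lemma IsPoissonProcess.lintegral_atoms_remove (hΦ : IsPoissonProcess μ lam Φ) {A B : Set Plane}
    (hA : MeasurableSet A) (hA' : Bornology.IsBounded A)
    (hB : MeasurableSet B) (hB' : Bornology.IsBounded B) :
    ∫⁻ ω, atoms (hΦ.config ω) {x | x ∈ A ∧ remove (hΦ.config ω, x) ∈ voidEvent B} ∂μ =
      hΦ.law (voidEvent B) * (lam * volume A) := by
  have hAdB := hA.diff hB
  have hBdA := hB.diff hA
  have hAB := hA.inter hB
  have hAdB' : Bornology.IsBounded (A \ B) := hA'.subset Set.sdiff_subset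
  have hBdA' : Bornology.IsBounded (B \ A) := hB'.subset Set.sdiff_subset
  have hAB' : Bornology.IsBounded (A ∩ B) := hA'.subset Set.inter_subset_left
  have hd : Disjoint (B \ A) (A ∩ B) := Set.disjoint_left.2 fun x hx hx' => hx.2 hx'.1
  simp_rw [atoms_remove_mem_voidEvent _ hA' hB']
  change ∫⁻ ω, (countIs 0 (Φ ω ∩ B).ncard * ((Φ ω ∩ (A \ B)).ncard : ℝ≥0∞) +
        countIs 0 (Φ ω ∩ (B \ A)).ncard * countIs 1 (Φ ω ∩ (A ∩ B)).ncard) ∂μ = _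
  have hm : Measurable fun ω =>
      countIs 0 (Φ ω ∩ B).ncard * ((Φ ω ∩ (A \ B)).ncard : ℝ≥0∞) :=
    ((measurable_countIs 0).comp (hΦ.measurable_count B hB hB')).mul
      (measurable_from_nat.comp (hΦ.measurable_count _ hAdB hAdB'))
  rw [lintegral_add_left hm,
    hΦ.lintegral_mul hB hB' hAdB hAdB' Set.disjoint_sdiff_right (countIs 0) (fun n => (n : ℝ≥0∞)),
    hΦ.lintegral_mul hBdA hBdA' hAB hAB' hd (countIs 0) (countIs 1),
    hΦ.lintegral_count hAdB hAdB', hΦ.lintegral_countIs 0 hB hB', hΦ.lintegral_countIs 0 hBdA hBdA',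
    hΦ.lintegral_countIs 1 hAB hAB', poissonMeasure_singleton_zero, poissonMeasure_singleton_zero,
    poissonMeasure_singleton_one, hΦ.law_voidEvent hB hB',
    ← mul_assoc (ENNReal.ofReal _) (ENNReal.ofReal _),
    ← ENNReal.ofReal_mul (by positivity), ← Real.exp_add]
  have hv : (volume (B \ A)).toReal + (volume (A ∩ B)).toReal = (volume B).toReal := by
    rw [← ENNReal.toReal_add hBdA'.measure_lt_top.ne hAB'.measure_lt_top.ne,
      ← measure_union hd hAB]
    congr 2
    ext x; simp only [Set.mem_union, Set.mem_sdiff, Set.mem_inter_iff]; tauto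
  have hv' : volume (A \ B) + volume (A ∩ B) = volume A := by
    rw [add_comm, measure_inter_add_sdiff A hB]
  rw [← hv']
  have he : -(((lam * (volume (B \ A)).toNNReal : ℝ≥0) : ℝ)) +
      -(((lam * (volume (A ∩ B)).toNNReal : ℝ≥0) : ℝ)) = -(lam * (volume B).toReal) := by
    rw [← hv]
    simp only [NNReal.coe_mul, ENNReal.coe_toNNReal_eq_toReal]
    ring
  rw [he]
  simp only [NNReal.coe_mul, ENNReal.coe_toNNReal_eq_toReal, ENNReal.coe_mul,
    ENNReal.coe_toNNReal hAB'.measure_lt_top.ne]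
  ring

lemma IsPoissonProcess.isProbabilityMeasure_law [IsProbabilityMeasure μ]
    (hΦ : IsPoissonProcess μ lam Φ) :
    IsProbabilityMeasure hΦ.law :=
  Measure.isProbabilityMeasure_map hΦ.measurable_config.aemeasurable

/-- The reduced Mecke equation: the reduced Campbell measure of a Poisson process is a product. -/
lemma IsPoissonProcess.campbell_eq_prod [IsProbabilityMeasure μ] (hΦ : IsPoissonProcess μ lam Φ) :
    (hΦ.law ⊗ₘ atoms).map (fun p => (remove p, p.2)) = hΦ.law.prod (lam • volume) := by
  have := hΦ.isProbabilityMeasure_law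
  have hm : Measurable fun p : Config × Plane => (remove p, p.2) :=
    measurable_remove.prodMk measurable_snd
  symm
  -- It suffices to compare the measures on products of a void event and a bounded Borel set; balls
  -- of integer radius provide the σ-finite exhaustion.
  refine Measure.prod_eq_generateFrom (C := voidEvents)
    (D := {A : Set Plane | MeasurableSet A ∧ Bornology.IsBounded A}) rfl ?_ isPiSystem_voidEvents
    ?_ ⟨fun _ => Set.univ, fun _ => ?_, fun _ => ?_, Set.iUnion_const _⟩
    ⟨fun n => Metric.ball 0 n, fun n => ⟨measurableSet_ball, Metric.isBounded_ball⟩, fun n => ?_,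
      Metric.iUnion_ball_nat 0⟩ ?_
  · refine le_antisymm (MeasurableSpace.generateFrom_le fun A hA => hA.1) fun A hA => ?_
    rw [show A = ⋃ n : ℕ, A ∩ Metric.ball 0 n by
      rw [← Set.inter_iUnion, Metric.iUnion_ball_nat, Set.inter_univ]]
    exact MeasurableSet.iUnion fun n => MeasurableSpace.measurableSet_generateFrom
      ⟨hA.inter measurableSet_ball, Metric.isBounded_ball.subset Set.inter_subset_right⟩
  · exact fun A hA B hB _ => ⟨hA.1.inter hB.1, hA.2.subset Set.inter_subset_left⟩
  · exact ⟨∅, MeasurableSet.empty, Bornology.isBounded_empty, voidEvent_empty.symm⟩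
  · exact measure_lt_top _ _
  · exact Metric.isBounded_ball.measure_lt_top
  · rintro _ ⟨B, hB, hB', rfl⟩ A ⟨hA, hA'⟩
    have hs := (measurableSet_voidEvent hB hB').prod hA
    rw [Measure.map_apply hm hs, Measure.compProd_apply (hm hs), law,
      lintegral_map (Kernel.measurable_kernel_prodMk_left (hm hs)) hΦ.measurable_config]
    have := hΦ.lintegral_atoms_remove hA hA' hB hB'
    rw [law] at this
    rw [show (lam • volume : Measure Plane) A = lam * volume A from rfl, ← this]
    refine lintegral_congr fun ω => congrArg _ ?_
    ext x
    simp [and_comm]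

lemma IsPoissonProcess.lintegral_mecke [IsProbabilityMeasure μ] (hΦ : IsPoissonProcess μ lam Φ)
    {F : Config × Plane → ℝ≥0∞} (hF : Measurable F) :
    ∫⁻ φ, ∫⁻ x, F (remove (φ, x), x) ∂atoms φ ∂hΦ.law = lam * ∫⁻ x, ∫⁻ φ, F (φ, x) ∂hΦ.law := by
  have := hΦ.isProbabilityMeasure_law
  have hm : Measurable fun p : Config × Plane => (remove p, p.2) :=
    measurable_remove.prodMk measurable_snd
  rw [← Measure.lintegral_compProd (f := fun p => F (remove p, p.2)) (hF.comp hm),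
    ← lintegral_map hF hm, hΦ.campbell_eq_prod, lintegral_prod_symm _ hF.aemeasurable]
  exact lintegral_smul_measure (lam : ℝ≥0∞) _

/-- The reduced Mecke equation for pairs of distinct atoms. -/
lemma IsPoissonProcess.lintegral_mecke_pair [IsProbabilityMeasure μ]
    (hΦ : IsPoissonProcess μ lam Φ) {F : Config × Plane × Plane → ℝ≥0∞} (hF : Measurable F) :
    ∫⁻ φ, ∫⁻ x, ∫⁻ y, F (remove (remove (φ, x), y), x, y) ∂atoms (remove (φ, x)) ∂atoms φ ∂hΦ.law =
      lam * (lam * ∫⁻ x, ∫⁻ y, ∫⁻ φ, F (φ, x, y) ∂hΦ.law) := by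
  have hH : Measurable fun p : Config × Plane =>
      ∫⁻ y, F (remove (p.1, y), p.2, y) ∂atoms p.1 := by
    refine Measurable.lintegral_kernel_prod_right' (κ := atoms.comap Prod.fst measurable_fst)
      (f := fun q : (Config × Plane) × Plane => F (remove (q.1.1, q.2), q.1.2, q.2)) ?_
    exact hF.comp ((measurable_remove.comp (by fun_prop)).prodMk (by fun_prop))
  -- One application handles the outer atom; the second, for fixed `x`, handles the inner one.
  rw [hΦ.lintegral_mecke hH]
  congr 1
  rw [← lintegral_const_mul']
  · refine lintegral_congr fun x => ?_
    exact hΦ.lintegral_mecke (F := fun p => F (p.1, x, p.2)) (hF.comp (by fun_prop))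
  · simp

end Poisson

/-! ### The area of the union of two discs -/

lemma integral_sqrt_one_sub_sq_half :
    ∫ x in (-1 : ℝ)..(1 / 2), √(1 - x ^ 2) = √3 / 8 + Real.pi / 3 := by
  have hpi := Real.pi_pos
  calc ∫ x in (-1 : ℝ)..(1 / 2), √(1 - x ^ 2)
      = ∫ x in Real.sin (-(Real.pi / 2))..Real.sin (Real.pi / 6), √(1 - x ^ 2) := by
        rw [Real.sin_neg, Real.sin_pi_div_two, Real.sin_pi_div_six]
    _ = ∫ x in (-(Real.pi / 2))..(Real.pi / 6), √(1 - Real.sin x ^ 2) * Real.cos x :=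
        (intervalIntegral.integral_comp_mul_deriv (fun x _ => Real.hasDerivAt_sin x)
          Real.continuousOn_cos (by fun_prop)).symm
    _ = ∫ x in (-(Real.pi / 2))..(Real.pi / 6), Real.cos x ^ 2 := by
        refine intervalIntegral.integral_congr fun x hx => ?_
        rw [Set.uIcc_of_le (by linarith)] at hx
        have hc : 0 ≤ Real.cos x := Real.cos_nonneg_of_mem_Icc ⟨hx.1, by linarith [hx.2]⟩
        rw [← Real.cos_sq', Real.sqrt_sq hc, sq]
    _ = _ := by
        rw [integral_cos_sq, Real.cos_neg, Real.cos_pi_div_two, Real.cos_pi_div_six,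
          Real.sin_pi_div_six]
        ring

lemma measurable_coord (i : Fin 2) : Measurable fun p : Plane => p i := by fun_prop

lemma volume_ball_inter_strip {s : Set ℝ} (hs : MeasurableSet s) (hs' : s ⊆ Set.Icc (-1) 1) :
    volume {p : Plane | p ∈ Metric.ball 0 1 ∧ p 0 ∈ s} =
      ENNReal.ofReal (∫ y in s, 2 * √(1 - y ^ 2)) := by
  have hmp := (volume_preserving_finTwoArrow ℝ).comp (PiLp.volume_preserving_ofLp (Fin 2))
  have hcont : Continuous fun y : ℝ => √(1 - y ^ 2) := by fun_prop
  have hint : IntegrableOn (fun y : ℝ => √(1 - y ^ 2)) s :=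
    (hcont.integrableOn_Icc (a := -1) (b := 1)).mono_set hs'
  have hreg : {p : Plane | p ∈ Metric.ball 0 1 ∧ p 0 ∈ s} =
      (MeasurableEquiv.finTwoArrow ∘ @WithLp.ofLp 2 (Fin 2 → ℝ)) ⁻¹'
        regionBetween (fun y => -√(1 - y ^ 2)) (fun y => √(1 - y ^ 2)) s := by
    ext p
    simp only [Set.mem_ofPred_eq, mem_ball_zero_iff, EuclideanSpace.norm_eq, Fin.sum_univ_two,
      Real.norm_eq_abs, sq_abs, regionBetween, Set.mem_preimage, Function.comp_apply,
      MeasurableEquiv.finTwoArrow_apply, Set.mem_Ioo, ← abs_lt]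
    rw [Real.sqrt_lt' one_pos, Real.lt_sqrt (abs_nonneg _), sq_abs, and_comm]
    refine and_congr_right fun _ => ?_
    constructor <;> intro h <;> linarith
  rw [hreg, hmp.measure_preimage (measurableSet_regionBetween (by fun_prop) (by fun_prop)
    hs).nullMeasurableSet, Measure.volume_eq_prod,
    volume_regionBetween_eq_integral (f := fun y => -√(1 - y ^ 2)) hint.neg hint hs
      fun y _ => by linarith [Real.sqrt_nonneg (1 - y ^ 2)]]
  congr 2
  ext y
  simp only [Pi.sub_apply]
  ring

/-- A unit vector of the plane. -/
noncomputable def unitVec : Plane := EuclideanSpace.single 0 1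

lemma pi_mul_two_sub_gam : Real.pi * (2 - gam) = √3 / 2 + 4 * Real.pi / 3 := by
  have := Real.pi_pos
  rw [gam]
  field_simp
  ring

lemma two_sub_gam_pos : 0 < 2 - gam := by
  have h := pi_mul_two_sub_gam
  have hpi := Real.pi_pos
  have : 0 < Real.pi * (2 - gam) := by rw [h]; positivity
  exact pos_of_mul_pos_right this hpi.le

/-- The perpendicular bisector of the two centres cuts the union into halves. On the side of the
origin the union is just the unit disc about the origin, truncated at first coordinate 1/2, and a
point reflection exchanges the halves. -/
lemma volume_union_ball_unitVec :
    volume (Metric.ball (0 : Plane) 1 ∪ Metric.ball unitVec 1) =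
      ENNReal.ofReal (Real.pi * (2 - gam)) := by
  have hval : ∫ y in Set.Ioc (-1 : ℝ) (1 / 2), 2 * √(1 - y ^ 2) = √3 / 4 + 2 * Real.pi / 3 := by
    rw [integral_const_mul, ← intervalIntegral.integral_of_le (by norm_num),
      integral_sqrt_one_sub_sq_half]
    ring
  have hm : MeasurableSet {p : Plane | p 0 < 1 / 2} :=
    measurableSet_lt (measurable_coord 0) measurable_const
  have hball : ∀ p : Plane, p ∈ Metric.ball 0 1 ↔ p 0 ^ 2 + p 1 ^ 2 < 1 := by
    intro p
    rw [mem_ball_zero_iff, EuclideanSpace.norm_eq, Real.sqrt_lt' one_pos]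
    simp
  have hball' : ∀ p : Plane, p ∈ Metric.ball unitVec 1 ↔ (p 0 - 1) ^ 2 + p 1 ^ 2 < 1 := by
    intro p
    rw [mem_ball_iff_norm, EuclideanSpace.norm_eq, Real.sqrt_lt' one_pos]
    simp [unitVec]
  have h1 : volume ((Metric.ball (0 : Plane) 1 ∪ Metric.ball unitVec 1) ∩ {p | p 0 < 1 / 2}) =
      ENNReal.ofReal (√3 / 4 + 2 * Real.pi / 3) := by
    -- The bisector belongs to the other half, whence an open interval here and a half-open one
    -- there.
    rw [← hval, integral_Ioc_eq_integral_Ioo, ← volume_ball_inter_strip measurableSet_Ioo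
      (fun y hy => ⟨hy.1.le, by linarith [hy.2]⟩)]
    congr 1
    ext p
    simp only [Set.mem_inter_iff, Set.mem_union, hball, hball', Set.mem_ofPred_eq, Set.mem_Ioo]
    constructor
    · rintro ⟨h | h, hp⟩
      · exact ⟨h, by nlinarith, hp⟩
      · exact ⟨by nlinarith, by nlinarith, hp⟩
    · rintro ⟨h, -, hp⟩
      exact ⟨Or.inl h, hp⟩
  have hc0 : ∀ p : Plane, MeasurableEquiv.subLeft unitVec p 0 = 1 - p 0 := by
    intro p
    change (unitVec - p) 0 = _
    simp [unitVec]
  have hc1 : ∀ p : Plane, MeasurableEquiv.subLeft unitVec p 1 = -p 1 := by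
    intro p
    change (unitVec - p) 1 = _
    simp [unitVec]
  have h2 : volume ((Metric.ball (0 : Plane) 1 ∪ Metric.ball unitVec 1) \ {p | p 0 < 1 / 2}) =
      ENNReal.ofReal (√3 / 4 + 2 * Real.pi / 3) := by
    -- The map `p ↦ unitVec - p` preserves area, exchanges the two centres and sends first
    -- coordinate t to 1 − t.
    rw [← hval, ← volume_ball_inter_strip measurableSet_Ioc
      (fun y hy => ⟨hy.1.le, by linarith [hy.2]⟩),
      ← (Measure.measurePreserving_sub_left volume unitVec).measure_preimage_equiv
        (f := MeasurableEquiv.subLeft unitVec)]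
    congr 1
    ext p
    simp only [Set.mem_sdiff, Set.mem_union, hball, hball', Set.mem_ofPred_eq, Set.mem_Ioc,
      Set.mem_preimage, not_lt, hc0, hc1]
    constructor
    · rintro ⟨h | h, hp⟩
      · exact ⟨by nlinarith, by nlinarith, by linarith⟩
      · exact ⟨by nlinarith, by nlinarith, by linarith⟩
    · rintro ⟨h, -, hp⟩
      exact ⟨Or.inr (by nlinarith), by linarith⟩
  rw [← measure_inter_add_sdiff _ hm, h1, h2, ← ENNReal.ofReal_add (by positivity) (by positivity),
    pi_mul_two_sub_gam]
  congr 1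
  ring

lemma volume_union_ball_of_norm_eq_one {v : Plane} (hv : ‖v‖ = 1) :
    volume (Metric.ball (0 : Plane) 1 ∪ Metric.ball v 1) =
      ENNReal.ofReal (Real.pi * (2 - gam)) := by
  have hu : ‖unitVec‖ = ‖v‖ := by simp [hv, unitVec]
  -- Reflection in the line orthogonal to `unitVec - v` carries one unit vector to the other.
  set R : Plane ≃ₗᵢ[ℝ] Plane := Submodule.reflection (Submodule.span ℝ {unitVec - v})ᗮ with hR
  have hRu : R unitVec = v := Submodule.reflection_sub hu
  rw [← volume_union_ball_unitVec, ← R.measurePreserving.measure_preimage_emb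
    R.toHomeomorph.measurableEmbedding, Set.preimage_union]
  rw [← hRu, R.preimage_ball, R.preimage_ball]
  simp

/-- The two open discs centred at `x` and `y`, each with the other centre on its boundary. -/
def twoDiscs (x y : Plane) : Set Plane := Metric.ball x (dist x y) ∪ Metric.ball y (dist x y)

lemma measurableSet_twoDiscs (x y : Plane) : MeasurableSet (twoDiscs x y) :=
  measurableSet_ball.union measurableSet_ball

lemma isBounded_twoDiscs (x y : Plane) : Bornology.IsBounded (twoDiscs x y) :=
  Metric.isBounded_ball.union Metric.isBounded_ball

open Pointwise in
-- Translating `x` to the origin and scaling by the distance reduces to unit discs; in the plane,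
-- area scales by the square.
lemma volume_twoDiscs (x y : Plane) :
    volume (twoDiscs x y) = ENNReal.ofReal (Real.pi * (2 - gam) * dist x y ^ 2) := by
  rcases eq_or_ne x y with rfl | hxy
  · simp [twoDiscs]
  set s := dist x y with hs
  have hs0 : 0 < s := dist_pos.2 hxy
  set v : Plane := s⁻¹ • (y - x) with hv
  have hvn : ‖v‖ = 1 := by
    rw [hv, norm_smul, ← dist_eq_norm, dist_comm y x, ← hs, Real.norm_eq_abs, abs_inv,
      abs_of_pos hs0, inv_mul_cancel₀ hs0.ne']
  have hsv : s • v = y - x := by rw [hv, smul_inv_smul₀ hs0.ne']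
  have h1 : (fun p => x + p) ⁻¹' twoDiscs x y =
      s • (Metric.ball (0 : Plane) 1 ∪ Metric.ball v 1) := by
    rw [Set.smul_set_union, smul_ball hs0.ne', smul_ball hs0.ne', hsv, smul_zero,
      Real.norm_of_nonneg hs0.le, mul_one, twoDiscs, Set.preimage_union, ← hs]
    congr 1 <;> ext p <;> simp [dist_eq_norm, sub_sub_eq_add_sub, add_comm]
  rw [← measure_preimage_add volume x, h1, Measure.addHaar_smul,
    volume_union_ball_of_norm_eq_one hvn, finrank_euclideanSpace_fin,
    ← ENNReal.ofReal_mul (abs_nonneg _), abs_of_nonneg (by positivity)]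
  congr 1
  ring

/-! ### The Rayleigh law and Gaussian integrals -/

section Rayleigh

variable {κ : ℝ}

/-- With σ² = 1/(2κ) the density is 2κ·s·exp(−κs²), the derivative of −exp(−κs²), which makes the
total mass and the distribution function explicit. -/
lemma rayleighMeasure_apply (hκ : 0 < κ) {A : Set ℝ} (hA : MeasurableSet A) :
    rayleighMeasure ((2 * κ) ^ (-(1 / 2) : ℝ)) A =
      ∫⁻ s in A ∩ Set.Ioi 0, ENNReal.ofReal (2 * κ * (s * Real.exp (-κ * s ^ 2))) := by
  have hσ : ((2 * κ) ^ (-(1 / 2) : ℝ)) ^ 2 = (2 * κ)⁻¹ := by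
    rw [← Real.rpow_natCast, ← Real.rpow_mul (by positivity)]
    norm_num [Real.rpow_neg_one]
  rw [rayleighMeasure, withDensity_apply _ hA, Set.inter_comm,
    ← Measure.restrict_restrict measurableSet_Ioi, ← lintegral_indicator measurableSet_Ioi]
  refine lintegral_congr fun s => ?_
  rw [hσ]
  rcases lt_trichotomy s 0 with hs | rfl | hs
  · rw [if_neg hs.not_ge, Set.indicator_of_notMem (by simpa using hs.le), ENNReal.ofReal_zero]
  · simp
  · rw [if_pos hs.le, Set.indicator_of_mem (by simpa using hs)]
    congr 1
    rw [show -s ^ 2 / (2 * (2 * κ)⁻¹) = -κ * s ^ 2 by field_simp]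
    field_simp

lemma hasDerivAt_neg_exp_neg_mul_sq (κ s : ℝ) :
    HasDerivAt (fun s => -Real.exp (-κ * s ^ 2)) (2 * κ * (s * Real.exp (-κ * s ^ 2))) s := by
  have h := ((hasDerivAt_pow 2 s).const_mul (-κ)).exp.neg
  refine HasDerivAt.congr_deriv (f := fun s => -Real.exp (-κ * s ^ 2)) h ?_
  push_cast
  ring

lemma tendsto_neg_exp_neg_mul_sq (hκ : 0 < κ) :
    Filter.Tendsto (fun s => -Real.exp (-κ * s ^ 2)) Filter.atTop (nhds 0) := by
  rw [← neg_zero]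
  refine (Real.tendsto_exp_atBot.comp ?_).neg
  exact (Filter.tendsto_pow_atTop two_ne_zero).const_mul_atTop_of_neg (by linarith)

lemma rayleighMeasure_univ (hκ : 0 < κ) :
    rayleighMeasure ((2 * κ) ^ (-(1 / 2) : ℝ)) Set.univ = 1 := by
  have hnn : ∀ s ∈ Set.Ioi (0 : ℝ), 0 ≤ 2 * κ * (s * Real.exp (-κ * s ^ 2)) := by
    intro s hs
    have : (0 : ℝ) < s := hs
    positivity
  rw [rayleighMeasure_apply hκ MeasurableSet.univ, Set.univ_inter,
    ← ofReal_integral_eq_lintegral_ofReal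
    (integrableOn_Ioi_deriv_of_nonneg' (fun s _ => hasDerivAt_neg_exp_neg_mul_sq κ s) hnn
      (tendsto_neg_exp_neg_mul_sq hκ)) ((ae_restrict_iff' measurableSet_Ioi).2 (.of_forall hnn)),
    integral_Ioi_of_hasDerivAt_of_nonneg' (fun s _ => hasDerivAt_neg_exp_neg_mul_sq κ s) hnn
      (tendsto_neg_exp_neg_mul_sq hκ)]
  simp

lemma rayleighMeasure_Iic (hκ : 0 < κ) {r : ℝ} (hr : 0 ≤ r) :
    rayleighMeasure ((2 * κ) ^ (-(1 / 2) : ℝ)) (Set.Iic r) =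
      ENNReal.ofReal (1 - Real.exp (-κ * r ^ 2)) := by
  have hc : Continuous fun s : ℝ => 2 * κ * (s * Real.exp (-κ * s ^ 2)) := by fun_prop
  have hnn : ∀ s ∈ Set.Ioc (0 : ℝ) r, 0 ≤ 2 * κ * (s * Real.exp (-κ * s ^ 2)) := by
    intro s hs
    have : (0 : ℝ) < s := hs.1
    positivity
  rw [rayleighMeasure_apply hκ measurableSet_Iic, Set.Iic_inter_Ioi,
    ← ofReal_integral_eq_lintegral_ofReal (hc.integrableOn_Ioc)
      ((ae_restrict_iff' measurableSet_Ioc).2 (.of_forall hnn)),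
    ← intervalIntegral.integral_of_le hr, intervalIntegral.integral_eq_sub_of_hasDerivAt
      (fun s _ => hasDerivAt_neg_exp_neg_mul_sq κ s) (hc.intervalIntegrable _ _)]
  congr 1
  simp
  ring

/-- Integration in polar coordinates of a Gaussian over a union of circles. -/
lemma lintegral_gaussian_norm (hκ : 0 < κ) {A : Set ℝ} (hA : MeasurableSet A) :
    ∫⁻ y : Plane, A.indicator (fun s => ENNReal.ofReal (Real.exp (-κ * s ^ 2))) ‖y‖ =
      ENNReal.ofReal (Real.pi / κ) * rayleighMeasure ((2 * κ) ^ (-(1 / 2) : ℝ)) A := by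
  set f : ℝ → ℝ := A.indicator fun s => Real.exp (-κ * s ^ 2) with hf
  have hf0 : ∀ s, 0 ≤ f s := fun s => Set.indicator_nonneg (fun s _ => (Real.exp_pos _).le) s
  have hyf : (fun s => s ^ (Module.finrank ℝ Plane - 1) • f s) =
      A.indicator fun s => s * Real.exp (-κ * s ^ 2) := by
    ext s
    by_cases hs : s ∈ A <;> simp [hf, hs]
  have hint0 : IntegrableOn (fun s => s * Real.exp (-κ * s ^ 2)) (Set.Ioi 0) :=
    (integrable_mul_exp_neg_mul_sq hκ).integrableOn
  have hint : Integrable (fun y : Plane => f ‖y‖) := by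
    rw [integrable_fun_norm_addHaar volume, hyf]
    exact hint0.indicator hA
  have hl : ∀ s, A.indicator (fun s => ENNReal.ofReal (Real.exp (-κ * s ^ 2))) s =
      ENNReal.ofReal (f s) := by
    intro s
    by_cases hs : s ∈ A <;> simp [hf, hs]
  simp_rw [hl]
  -- The polar formula has constant dimension times unit-ball volume, here 2π = (π/κ)·2κ.
  have hball : volume.real (Metric.ball (0 : Plane) 1) = Real.pi := by
    rw [Measure.real, EuclideanSpace.volume_ball_fin_two]
    simp [Real.pi_pos.le]
  rw [← ofReal_integral_eq_lintegral_ofReal hint (.of_forall fun y => hf0 _),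
    integral_fun_norm_addHaar, hyf, hball, rayleighMeasure_apply hκ hA, Set.inter_comm,
    ← ofReal_integral_eq_lintegral_ofReal, ← ENNReal.ofReal_mul (by positivity),
    setIntegral_indicator hA, integral_const_mul]
  · congr 1
    simp only [finrank_euclideanSpace_fin, nsmul_eq_mul, smul_eq_mul, Nat.cast_ofNat]
    rw [← mul_assoc, ← mul_assoc]
    congr 1
    field_simp
  · exact (hint0.mono_set Set.inter_subset_left).const_mul _
  · refine (ae_restrict_iff' (measurableSet_Ioi.inter hA)).2 (.of_forall fun s hs => ?_)
    have : (0 : ℝ) < s := hs.1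
    simp only [Pi.zero_apply]
    positivity

end Rayleigh

/-! ### Cooperation as an empty region -/

/-- An atom violates one of the two minimality conditions exactly when it is strictly closer than
`dist x y` to one of the centres. Open discs match the weak inequalities; both centres must be
removed, as each lies in its own disc. -/
lemma isMutuallyNearest_iff {φ : Set Plane} {x y : Plane} :
    IsMutuallyNearest φ x y ↔ x ∈ φ ∧ y ∈ φ \ {x} ∧ ((φ \ {x}) \ {y}) ∩ twoDiscs x y = ∅ := by
  simp only [IsMutuallyNearest, IsNearest, twoDiscs, Set.eq_empty_iff_forall_notMem,
    Set.mem_inter_iff, Set.mem_sdiff, Set.mem_singleton_iff, Set.mem_union, Metric.mem_ball]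
  constructor
  · rintro ⟨⟨hx, hy, h1⟩, -, -, h2⟩
    refine ⟨hx, hy, ?_⟩
    rintro z ⟨⟨⟨hz, hzx⟩, hzy⟩, h | h⟩
    · exact absurd (h1 z ⟨hz, hzx⟩) (by rw [dist_comm x z]; exact h.not_ge)
    · exact absurd (h2 z ⟨hz, hzy⟩) (by rw [dist_comm y z, dist_comm y x]; exact h.not_ge)
  · rintro ⟨hx, hy, h⟩
    refine ⟨⟨hx, hy, fun z hz => ?_⟩, hy.1, ⟨hx, fun h => hy.2 h.symm⟩, fun z hz => ?_⟩
    · by_cases hzy : z = y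
      · rw [hzy]
      · by_contra hlt
        rw [dist_comm x z] at hlt
        exact h z ⟨⟨hz, hzy⟩, Or.inl (not_le.1 hlt)⟩
    · by_cases hzx : z = x
      · rw [hzx]
      · by_contra hlt
        rw [dist_comm y z, dist_comm y x] at hlt
        exact h z ⟨⟨⟨hz.1, hzx⟩, hz.2⟩, Or.inr (not_le.1 hlt)⟩

/-- The region moves with the two points, so joint measurability does not follow from that of a
single void event; it comes from quantifying over the atoms. -/
lemma measurableSet_voidEvent_twoDiscs :
    MeasurableSet {p : Config × Plane × Plane | p.1 ∈ voidEvent (twoDiscs p.2.1 p.2.2)} := by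
  have : {p : Config × Plane × Plane | p.1 ∈ voidEvent (twoDiscs p.2.1 p.2.2)} =
      {p | ∀ z ∈ p.1.1, (p, z) ∈ {q : (Config × Plane × Plane) × Plane |
        dist q.2 q.1.2.1 < dist q.1.2.1 q.1.2.2 ∨ dist q.2 q.1.2.2 < dist q.1.2.1 q.1.2.2}ᶜ} := by
    ext p
    simp only [voidEvent, twoDiscs, Set.mem_ofPred_eq, Set.eq_empty_iff_forall_notMem,
      Set.mem_inter_iff, Set.mem_union, Metric.mem_ball, Set.mem_compl_iff, not_and]
  rw [this]
  refine measurableSet_forall_atoms measurable_fst (MeasurableSet.compl ?_)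
  have h1 : Measurable fun q : (Config × Plane × Plane) × Plane => dist q.2 q.1.2.1 := by fun_prop
  have h2 : Measurable fun q : (Config × Plane × Plane) × Plane => dist q.2 q.1.2.2 := by fun_prop
  have h3 : Measurable fun q : (Config × Plane × Plane) × Plane => dist q.1.2.1 q.1.2.2 := by
    fun_prop
  exact (measurableSet_lt h1 h3).union (measurableSet_lt h2 h3)

/-- Configurations, with two further points at a distance in `A` such that no atom of the
configuration is closer to one of them than the other. -/
def pairEvent (A : Set ℝ) : Set (Config × Plane × Plane) :=
  {p | dist p.2.1 p.2.2 ∈ A ∧ p.1 ∈ voidEvent (twoDiscs p.2.1 p.2.2)}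

lemma measurableSet_pairEvent {A : Set ℝ} (hA : MeasurableSet A) :
    MeasurableSet (pairEvent A) := by
  have h : Measurable fun p : Config × Plane × Plane => dist p.2.1 p.2.2 := by fun_prop
  exact (h hA).inter measurableSet_voidEvent_twoDiscs

/-- Removal of two atoms, keeping track of them. -/
def removePair (p : (Config × Plane) × Plane) : Config × Plane × Plane :=
  (remove (remove p.1, p.2), p.1.2, p.2)

lemma measurable_removePair : Measurable removePair :=
  (measurable_remove.comp ((measurable_remove.comp measurable_fst).prodMk measurable_snd)).prodMk
    (by fun_prop)

/-- The points that become paired, at a distance in `A`, with an atom of a configuration. -/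
def pairedEvent (A : Set ℝ) : Set (Config × Plane) :=
  {p | ∃ y ∈ (remove p).1, removePair (p, y) ∈ pairEvent A}

lemma measurableSet_pairedEvent {A : Set ℝ} (hA : MeasurableSet A) :
    MeasurableSet (pairedEvent A) :=
  measurableSet_exists_atoms (s := removePair ⁻¹' pairEvent A) measurable_remove
    (measurable_removePair (measurableSet_pairEvent hA))

lemma isMutuallyNearest_iff_mem_pairEvent {φ : Config} {x y : Plane} {A : Set ℝ} (hx : x ∈ φ.1) :
    (IsMutuallyNearest φ.1 x y ∧ dist x y ∈ A) ↔
      y ∈ (remove (φ, x)).1 ∧ removePair ((φ, x), y) ∈ pairEvent A := by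
  rw [isMutuallyNearest_iff]
  constructor
  · rintro ⟨⟨-, hy, h⟩, hd⟩
    exact ⟨hy, hd, h⟩
  · rintro ⟨hy, hd, h⟩
    exact ⟨⟨hx, hy, h⟩, hd⟩

lemma mem_pairedEvent_iff {φ : Config} {x : Plane} {A : Set ℝ} (hx : x ∈ φ.1) :
    (φ, x) ∈ pairedEvent A ↔ ∃ y, IsMutuallyNearest φ.1 x y ∧ dist x y ∈ A := by
  simp_rw [isMutuallyNearest_iff_mem_pairEvent hx]
  rfl

lemma measurable_atoms_section {s : Set (Config × Plane)} (hs : MeasurableSet s) :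
    Measurable fun φ => atoms φ {x | (φ, x) ∈ s} :=
  Kernel.measurable_kernel_prodMk_left hs

lemma measurableSet_pairedEvent_window {D : Set Plane} (hD : MeasurableSet D) {A : Set ℝ}
    (hA : MeasurableSet A) :
    MeasurableSet {p : Config × Plane | p.2 ∈ D ∧ p ∈ pairedEvent A} :=
  (measurable_snd hD).inter (measurableSet_pairedEvent hA)

lemma pairedAtoms_inter_eq (φ : Config) (D : Set Plane) :
    pairedAtoms φ.1 ∩ D = φ.1 ∩ {x | x ∈ D ∧ (φ, x) ∈ pairedEvent Set.univ} := by
  ext x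
  simp only [pairedAtoms, Set.mem_inter_iff, Set.mem_ofPred_eq]
  constructor
  · rintro ⟨⟨hx, y, hy⟩, hD⟩
    exact ⟨hx, hD, (mem_pairedEvent_iff hx).2 ⟨y, hy, trivial⟩⟩
  · rintro ⟨hx, hD, h⟩
    obtain ⟨y, hy, -⟩ := (mem_pairedEvent_iff hx).1 h
    exact ⟨⟨hx, y, hy⟩, hD⟩

variable {Ω : Type*} [MeasurableSpace Ω] {μ : Measure Ω} {lam : ℝ≥0} {Φ : Ω → Set Plane}

lemma IsPointProcess.pairedAtoms (hΦ : IsPointProcess Φ) :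
    IsPointProcess fun ω => pairedAtoms (Φ ω) := by
  refine ⟨fun ω B hB => (hΦ.locallyFinite ω B hB).subset
    (Set.inter_subset_inter_left _ fun x hx => hx.1), fun B hB hB' => ?_⟩
  have h : Measurable fun ω => ((PairedPoisson.pairedAtoms (Φ ω) ∩ B).ncard : ℝ≥0∞) := by
    convert (measurable_atoms_section (measurableSet_pairedEvent_window hB
      MeasurableSet.univ)).comp hΦ.measurable_config using 1
    ext ω
    have hb : Bornology.IsBounded {x | x ∈ B ∧ (hΦ.config ω, x) ∈ pairedEvent Set.univ} :=
      hB'.subset fun x hx => hx.1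
    simp only [Function.comp_apply, Set.mem_ofPred_eq]
    rw [atoms_apply_of_isBounded _ hb, ← pairedAtoms_inter_eq]
    rfl
  refine measurable_to_countable' fun n => ?_
  convert h (measurableSet_singleton (n : ℝ≥0∞)) using 1
  ext ω
  simp

/-! ### Absence of ties and the mean number of paired atoms -/

section Poisson

variable [IsProbabilityMeasure μ]

lemma IsPoissonProcess.lintegral_atoms (hΦ : IsPoissonProcess μ lam Φ) {S : Set Plane}
    (hS : MeasurableSet S) : ∫⁻ φ, atoms φ S ∂hΦ.law = lam * volume S := by
  have := hΦ.isProbabilityMeasure_law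
  have h := hΦ.lintegral_mecke (F := fun p => S.indicator 1 p.2)
    ((measurable_one.indicator hS).comp measurable_snd)
  simpa [lintegral_indicator_one hS] using h

lemma measurable_lintegral_removePair {F : Config × Plane × Plane → ℝ≥0∞} (hF : Measurable F) :
    Measurable fun p : Config × Plane => ∫⁻ y, F (removePair (p, y)) ∂atoms (remove p) :=
  Measurable.lintegral_kernel_prod_right' (κ := atoms.comap remove measurable_remove)
    (hF.comp measurable_removePair)

lemma IsPoissonProcess.lintegral_removePair (hΦ : IsPoissonProcess μ lam Φ)
    {F : Config × Plane × Plane → ℝ≥0∞} (hF : Measurable F) :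
    ∫⁻ φ, ∫⁻ x, ∫⁻ y, F (removePair ((φ, x), y)) ∂atoms (remove (φ, x)) ∂atoms φ ∂hΦ.law =
      lam * (lam * ∫⁻ x, ∫⁻ y, ∫⁻ φ, F (φ, x, y) ∂hΦ.law) :=
  hΦ.lintegral_mecke_pair hF

/-- Almost surely, no atom of a Poisson process has two others at the same distance. -/
lemma IsPoissonProcess.ae_dist_ne (hΦ : IsPoissonProcess μ lam Φ) :
    ∀ᵐ φ ∂hΦ.law, ∀ x ∈ φ.1, ∀ y ∈ (remove (φ, x)).1,
      ∀ z ∈ (removePair ((φ, x), y)).1.1, dist z x ≠ dist x y := by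
  have hS : MeasurableSet {q : (Config × Plane × Plane) × Plane |
      dist q.2 q.1.2.1 = dist q.1.2.1 q.1.2.2} :=
    measurableSet_eq_fun (by fun_prop) (by fun_prop)
  have hF : Measurable fun p : Config × Plane × Plane =>
      atoms p.1 {z | dist z p.2.1 = dist p.2.1 p.2.2} :=
    Kernel.measurable_kernel_prodMk_left (κ := atoms.comap Prod.fst measurable_fst) hS
  have h0 := hΦ.lintegral_removePair hF
  -- After the Mecke equation for pairs, the remaining configuration is again Poisson, and the
  -- circle about `x` through `y` has area zero.
  have h1 : ∀ x y : Plane, ∫⁻ φ, atoms φ {z | dist z x = dist x y} ∂hΦ.law = 0 := by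
    intro x y
    rw [hΦ.lintegral_atoms (measurableSet_eq_fun (by fun_prop) (by fun_prop))]
    have : volume {z | dist z x = dist x y} = 0 := Measure.addHaar_sphere volume x (dist x y)
    rw [this, mul_zero]
  simp only [h1, lintegral_zero, mul_zero] at h0
  have hH := measurable_lintegral_removePair hF
  have hm : Measurable fun φ => ∫⁻ x, (fun p : Config × Plane => ∫⁻ y,
      atoms (removePair (p, y)).1 {z | dist z (removePair (p, y)).2.1 =
        dist (removePair (p, y)).2.1 (removePair (p, y)).2.2} ∂atoms (remove p)) (φ, x)
        ∂atoms φ :=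
    Measurable.lintegral_kernel_prod_right' hH
  rw [lintegral_eq_zero_iff hm] at h0
  filter_upwards [h0] with φ hφ
  have hφ' := (ae_atoms_iff φ _).1
    ((lintegral_eq_zero_iff (hH.comp (measurable_prodMk_left (x := φ)))).1 hφ)
  intro x hx
  have hx' := (ae_atoms_iff _ _).1 ((lintegral_eq_zero_iff ((hF.comp measurable_removePair).comp
    (measurable_prodMk_left (x := (φ, x))))).1 (hφ' x hx))
  intro y hy z hz hd
  exact Set.eq_empty_iff_forall_notMem.1 ((atoms_eq_zero_iff _ _).1 (hx' y hy)) z ⟨hz, hd⟩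

/-- Without ties an atom has at most one partner, so the inner sum over `y` is 0 or 1 and the double
sum over ordered pairs counts paired atoms. -/
lemma lintegral_indicator_pairEvent {φ : Config} {D : Set Plane} (hD : MeasurableSet D)
    {A : Set ℝ} (hA : MeasurableSet A)
    (h : ∀ x ∈ φ.1, ∀ y ∈ (remove (φ, x)).1,
      ∀ z ∈ (removePair ((φ, x), y)).1.1, dist z x ≠ dist x y) :
    ∫⁻ x, ∫⁻ y, {p : Config × Plane × Plane | p.2.1 ∈ D ∧ p ∈ pairEvent A}.indicator 1
      (removePair ((φ, x), y)) ∂atoms (remove (φ, x)) ∂atoms φ =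
      atoms φ {x | x ∈ D ∧ (φ, x) ∈ pairedEvent A} := by
  have hm : MeasurableSet {x | x ∈ D ∧ (φ, x) ∈ pairedEvent A} :=
    measurable_prodMk_left (measurableSet_pairedEvent_window hD hA)
  have hm' : MeasurableSet {p : Config × Plane × Plane | p.2.1 ∈ D ∧ p ∈ pairEvent A} :=
    ((measurable_fst.comp measurable_snd) hD).inter (measurableSet_pairEvent hA)
  rw [← lintegral_indicator_one hm]
  refine lintegral_congr_ae ((ae_atoms_iff φ _).2 fun x hx => ?_)
  change ∫⁻ y, ((fun y => removePair ((φ, x), y)) ⁻¹' {p : Config × Plane × Plane |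
    p.2.1 ∈ D ∧ p ∈ pairEvent A}).indicator 1 y ∂atoms (remove (φ, x)) = _
  have hpre : MeasurableSet ((fun y => removePair ((φ, x), y)) ⁻¹'
      {p : Config × Plane × Plane | p.2.1 ∈ D ∧ p ∈ pairEvent A}) :=
    (measurable_removePair.comp measurable_prodMk_left) hm'
  rw [lintegral_indicator_one hpre, atoms_apply]
  by_cases hxm : x ∈ {x | x ∈ D ∧ (φ, x) ∈ pairedEvent A}
  · rw [Set.indicator_of_mem hxm]
    obtain ⟨hxD, y, hy, hyA⟩ := hxm
    have : (remove (φ, x)).1 ∩ ((fun y => removePair ((φ, x), y)) ⁻¹'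
        {p : Config × Plane × Plane | p.2.1 ∈ D ∧ p ∈ pairEvent A}) = {y} := by
      ext z
      constructor
      · rintro ⟨hz, -, hzA⟩
        by_contra hne
        -- Two partners of `x` would each be at most as far from `x` as the other, which is an
        -- excluded tie.
        have h1 := ((isMutuallyNearest_iff_mem_pairEvent hx).2 ⟨hy, hyA⟩).1.1.2.2 z hz
        have h2 := ((isMutuallyNearest_iff_mem_pairEvent hx).2 ⟨hz, hzA⟩).1.1.2.2 y hy
        exact h x hx y hy z ⟨hz, hne⟩ ((dist_comm z x).trans (le_antisymm h2 h1))
      · rintro rfl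
        exact ⟨hy, hxD, hyA⟩
    rw [this]
    simp
  · rw [Set.indicator_of_notMem hxm]
    have : (remove (φ, x)).1 ∩ ((fun y => removePair ((φ, x), y)) ⁻¹'
        {p : Config × Plane × Plane | p.2.1 ∈ D ∧ p ∈ pairEvent A}) = ∅ := by
      rw [Set.eq_empty_iff_forall_notMem]
      rintro y ⟨hy, hyD, hyA⟩
      exact hxm ⟨hyD, y, hy, hyA⟩
    rw [this]
    simp

/-- The mean number of paired atoms in a window, with the distance to the partner in `A`. -/
lemma IsPoissonProcess.lintegral_pairedEvent (hΦ : IsPoissonProcess μ lam Φ) (hlam : 0 < lam)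
    {D : Set Plane} (hD : MeasurableSet D) {A : Set ℝ} (hA : MeasurableSet A) :
    ∫⁻ ω, atoms (hΦ.config ω) {x | x ∈ D ∧ (hΦ.config ω, x) ∈ pairedEvent A} ∂μ =
      lam * (lam * (ENNReal.ofReal (Real.pi / (lam * Real.pi * (2 - gam))) * volume D)) *
        rayleighMeasure ((2 * (lam * Real.pi * (2 - gam))) ^ (-(1 / 2) : ℝ)) A := by
  have hκ : 0 < lam * Real.pi * (2 - gam) :=
    mul_pos (mul_pos (NNReal.coe_pos.2 hlam) Real.pi_pos) two_sub_gam_pos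
  have hm' : MeasurableSet {p : Config × Plane × Plane | p.2.1 ∈ D ∧ p ∈ pairEvent A} :=
    ((measurable_fst.comp measurable_snd) hD).inter (measurableSet_pairEvent hA)
  have hmap := lintegral_map (μ := μ)
    (measurable_atoms_section (measurableSet_pairedEvent_window hD hA)) hΦ.measurable_config
  simp only [Set.mem_ofPred_eq] at hmap
  rw [← hmap]
  change ∫⁻ φ, _ ∂hΦ.law = _
  rw [lintegral_congr_ae (hΦ.ae_dist_ne.mono fun φ hφ =>
    (lintegral_indicator_pairEvent hD hA hφ).symm),
    hΦ.lintegral_removePair (measurable_one.indicator hm')]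
  have h1 : ∀ x y : Plane, ∫⁻ φ, {p : Config × Plane × Plane |
      p.2.1 ∈ D ∧ p ∈ pairEvent A}.indicator 1 (φ, x, y) ∂hΦ.law =
      D.indicator 1 x * A.indicator (fun s => ENNReal.ofReal
        (Real.exp (-(lam * Real.pi * (2 - gam)) * s ^ 2))) ‖y - x‖ := by
    intro x y
    rw [← dist_eq_norm, dist_comm y x]
    by_cases hx : x ∈ D
    · by_cases hy : dist x y ∈ A
      · have h2 : ∀ φ, {p : Config × Plane × Plane |
            p.2.1 ∈ D ∧ p ∈ pairEvent A}.indicator (1 : Config × Plane × Plane → ℝ≥0∞) (φ, x, y) =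
            (voidEvent (twoDiscs x y)).indicator 1 φ := by
          intro φ
          by_cases hφ : φ ∈ voidEvent (twoDiscs x y) <;> simp [pairEvent, hx, hy, hφ]
        simp_rw [h2]
        rw [lintegral_indicator_one (measurableSet_voidEvent (measurableSet_twoDiscs x y)
          (isBounded_twoDiscs x y)), hΦ.law_voidEvent (measurableSet_twoDiscs x y)
          (isBounded_twoDiscs x y), volume_twoDiscs, ENNReal.toReal_ofReal
          (mul_nonneg (mul_nonneg Real.pi_pos.le two_sub_gam_pos.le) (sq_nonneg _)),
          Set.indicator_of_mem hx, Set.indicator_of_mem hy, Pi.one_apply, one_mul]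
        congr 2
        ring
      · simp [pairEvent, hy]
    · simp [hx]
  simp_rw [h1]
  have h3 : ∀ x : Plane, ∫⁻ y, D.indicator 1 x * A.indicator (fun s => ENNReal.ofReal
        (Real.exp (-(lam * Real.pi * (2 - gam)) * s ^ 2))) ‖y - x‖ =
      D.indicator 1 x * (ENNReal.ofReal (Real.pi / (lam * Real.pi * (2 - gam))) *
        rayleighMeasure ((2 * (lam * Real.pi * (2 - gam))) ^ (-(1 / 2) : ℝ)) A) := by
    intro x
    -- Translation invariance in `y` removes `x`, so the radial integral is the same for every point
    -- of `D`.
    rw [lintegral_const_mul' _ _ (by by_cases hx : x ∈ D <;> simp [hx]),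
      lintegral_sub_right_eq_self (fun y => A.indicator (fun s => ENNReal.ofReal
        (Real.exp (-(lam * Real.pi * (2 - gam)) * s ^ 2))) ‖y‖) x, lintegral_gaussian_norm hκ hA]
  simp_rw [h3]
  rw [lintegral_mul_const _ (measurable_one.indicator hD), lintegral_indicator_one hD]
  ring

end Poisson

/-! ### Palm probabilities of the paired atoms -/

lemma mem_seenFrom {x z : Plane} {φ : Set Plane} : z ∈ seenFrom x φ ↔ z + x ∈ φ := by
  simp only [seenFrom, Set.mem_image]
  constructor
  · rintro ⟨w, hw, rfl⟩
    simpa using hw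
  · exact fun h => ⟨_, h, by simp⟩

lemma isNearest_seenFrom {x a b : Plane} {φ : Set Plane} :
    IsNearest (seenFrom x φ) a b ↔ IsNearest φ (a + x) (b + x) := by
  simp only [IsNearest, mem_seenFrom, Set.mem_sdiff, Set.mem_singleton_iff, add_left_inj,
    dist_add_right]
  refine and_congr_right fun _ => and_congr_right fun _ => ⟨fun h z hz => ?_, fun h z hz => ?_⟩
  · have h1 : ¬ z - x = a := fun h => hz.2 (by rw [← h]; simp)
    have h2 := h (z - x) ⟨by simpa using hz.1, h1⟩
    rwa [← dist_add_right a (z - x) x, sub_add_cancel] at h2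
  · have := h (z + x) ⟨hz.1, fun h => hz.2 (add_right_cancel h)⟩
    rwa [dist_add_right] at this

lemma isMutuallyNearest_seenFrom {x y : Plane} {φ : Set Plane} :
    IsMutuallyNearest (seenFrom x φ) 0 y ↔ IsMutuallyNearest φ x (y + x) := by
  simp only [IsMutuallyNearest, isNearest_seenFrom, zero_add]

lemma IsMutuallyNearest.symm {φ : Set Plane} {x y : Plane} (h : IsMutuallyNearest φ x y) :
    IsMutuallyNearest φ y x := ⟨h.2, h.1⟩

/-- The nearest paired atom of a paired atom is its partner. -/
lemma IsMutuallyNearest.infEDist_pairedAtoms {φ : Set Plane} {x y : Plane}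
    (h : IsMutuallyNearest φ x y) :
    Metric.infEDist x (PairedPoisson.pairedAtoms φ \ {x}) = edist x y := by
  refine le_antisymm (Metric.infEDist_le_edist_of_mem ⟨⟨h.2.1, x, h.symm⟩, h.1.2.1.2⟩) ?_
  refine Metric.le_infEDist.2 fun z hz => ?_
  rw [edist_dist, edist_dist]
  exact ENNReal.ofReal_le_ofReal (h.1.2.2 z ⟨hz.1.1, hz.2⟩)

/-- The two Palm numerators agree for every outcome: seen from a paired atom, the distance to the
other paired atoms is the distance to any partner. No probability enters. -/
lemma pairedNN_eq_pairDistanceLaw (μ : Measure Ω) (Φ : Ω → Set Plane) (D : Set Plane) {r : ℝ}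
    (hr : 0 ≤ r) : pairedNN μ Φ D r = pairDistanceLaw μ Φ D (Set.Iic r) := by
  simp only [pairedNN, pairDistanceLaw, palmProb]
  congr 1
  refine lintegral_congr fun ω => ?_
  congr 2
  ext x
  simp only [Set.mem_ofPred_eq, Set.mem_Iic]
  refine and_congr_right fun hx => ?_
  obtain ⟨⟨-, y, hy⟩, -⟩ := hx
  rw [← sub_add_cancel y x, ← isMutuallyNearest_seenFrom] at hy
  constructor
  · intro h
    rw [hy.infEDist_pairedAtoms, edist_le_ofReal hr] at h
    exact ⟨_, hy, h⟩
  · rintro ⟨z, hz, hzr⟩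
    rwa [hz.infEDist_pairedAtoms, edist_le_ofReal hr]

/-- Numerator and denominator share the factor λ²|D|π/κ, and the Rayleigh measure has total mass 1.
Positive density and a bounded window of positive area make the factor nonzero and finite, so it
cancels. -/
lemma IsPoissonProcess.pairDistanceLaw_eq [IsProbabilityMeasure μ]
    (hΦ : IsPoissonProcess μ lam Φ) (hlam : 0 < lam) {D : Set Plane} (hD : MeasurableSet D)
    (hD' : Bornology.IsBounded D) (hD0 : volume D ≠ 0) {A : Set ℝ} (hA : MeasurableSet A) :
    pairDistanceLaw μ Φ D A =
      rayleighMeasure ((2 * (lam * Real.pi * (2 - gam))) ^ (-(1 / 2) : ℝ)) A := by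
  have hκ : 0 < lam * Real.pi * (2 - gam) :=
    mul_pos (mul_pos (NNReal.coe_pos.2 hlam) Real.pi_pos) two_sub_gam_pos
  have hnum : ∫⁻ ω, (({x | x ∈ PairedPoisson.pairedAtoms (Φ ω) ∩ D ∧ seenFrom x (Φ ω) ∈
      {φ | ∃ y, IsMutuallyNearest φ 0 y ∧ dist 0 y ∈ A}}.encard : ℕ∞) : ℝ≥0∞) ∂μ =
      ∫⁻ ω, atoms (hΦ.config ω) {x | x ∈ D ∧ (hΦ.config ω, x) ∈ pairedEvent A} ∂μ := by
    refine lintegral_congr fun ω => ?_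
    rw [atoms_apply]
    congr 2
    ext x
    simp only [Set.mem_ofPred_eq, isMutuallyNearest_seenFrom, Set.mem_inter_iff]
    constructor
    · rintro ⟨⟨hx, hxD⟩, y, hy, hyA⟩
      refine ⟨hx.1, hxD, (mem_pairedEvent_iff (φ := hΦ.config ω) hx.1).2 ⟨y + x, hy, ?_⟩⟩
      simpa using hyA
    · rintro ⟨hx, hxD, h⟩
      obtain ⟨y, hy, hyA⟩ := (mem_pairedEvent_iff (φ := hΦ.config ω) hx).1 h
      refine ⟨⟨⟨hx, y, hy⟩, hxD⟩, y - x, (sub_add_cancel y x).symm ▸ hy, ?_⟩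
      rwa [← dist_add_right 0 (y - x) x, zero_add, sub_add_cancel]
  have hden : ∫⁻ ω, (((PairedPoisson.pairedAtoms (Φ ω) ∩ D).encard : ℕ∞) : ℝ≥0∞) ∂μ =
      ∫⁻ ω, atoms (hΦ.config ω) {x | x ∈ D ∧ (hΦ.config ω, x) ∈ pairedEvent Set.univ} ∂μ := by
    refine lintegral_congr fun ω => ?_
    rw [atoms_apply, ← pairedAtoms_inter_eq]
    rfl
  rw [pairDistanceLaw, palmProb, hnum, hden, hΦ.lintegral_pairedEvent hlam hD hA,
    hΦ.lintegral_pairedEvent hlam hD MeasurableSet.univ, rayleighMeasure_univ hκ, mul_one,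
    mul_comm, ENNReal.mul_div_cancel_right]
  · have h1 : ENNReal.ofReal (Real.pi / (lam * Real.pi * (2 - gam))) ≠ 0 := by
      rw [Ne, ENNReal.ofReal_eq_zero, not_le]
      exact div_pos Real.pi_pos hκ
    simp [hD0, h1, hlam.ne']
  · exact ENNReal.mul_ne_top ENNReal.coe_ne_top (ENNReal.mul_ne_top ENNReal.coe_ne_top
      (ENNReal.mul_ne_top ENNReal.ofReal_ne_top hD'.measure_lt_top.ne))

end PairedPoisson

theorem theorem3 {Ω : Type*} [MeasurableSpace Ω] (μ : Measure Ω) [IsProbabilityMeasure μ]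
    (lam : ℝ≥0) (hlam : 0 < lam) (Φ : Ω → Set PairedPoisson.Plane)
    (hΦ : PairedPoisson.IsPoissonProcess μ lam Φ) :
    PairedPoisson.IsPointProcess (fun ω => PairedPoisson.pairedAtoms (Φ ω)) ∧
    ∀ D : Set PairedPoisson.Plane, MeasurableSet D → Bornology.IsBounded D → volume D ≠ 0 →
      (∀ r : ℝ, 0 < r →
        PairedPoisson.pairedNN μ Φ D r =
          ENNReal.ofReal
            (1 - Real.exp (-((lam : ℝ) * Real.pi * r ^ 2 * (2 - PairedPoisson.gam))))) ∧
      (∀ A : Set ℝ, MeasurableSet A →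
        PairedPoisson.pairDistanceLaw μ Φ D A =
          PairedPoisson.rayleighMeasure
            ((2 * (lam : ℝ) * Real.pi * (2 - PairedPoisson.gam)) ^ (-(1 / 2) : ℝ)) A) := by
  have hκ : 0 < lam * Real.pi * (2 - PairedPoisson.gam) :=
    mul_pos (mul_pos (NNReal.coe_pos.2 hlam) Real.pi_pos) PairedPoisson.two_sub_gam_pos
  have hassoc : 2 * (lam : ℝ) * Real.pi * (2 - PairedPoisson.gam) =
      2 * (lam * Real.pi * (2 - PairedPoisson.gam)) := by ring
  refine ⟨hΦ.toIsPointProcess.pairedAtoms, fun D hD hD' hD0 => ⟨fun r hr => ?_, fun A hA => ?_⟩⟩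
  · rw [PairedPoisson.pairedNN_eq_pairDistanceLaw μ Φ D hr.le,
      hΦ.pairDistanceLaw_eq hlam hD hD' hD0 measurableSet_Iic,
      PairedPoisson.rayleighMeasure_Iic hκ hr.le]
    congr 3
    ring
  · rw [hassoc, hΦ.pairDistanceLaw_eq hlam hD hD' hD0 hA]
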